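/- Let $d\ge 1$ be an integer, $\alpha>0$ and $T>0$. For $f\in L^2(\mathbb{R}^d)$ (complex-valued) let $(-\Delta)^{\alpha/2}f$ be defined by the Fourier multiplier $|\xi|^{\alpha}$ (for the Fourier transform $\int e^{-i x\cdot\xi}f(x)\,dx$), let $H^\alpha(\mathbb{R}^d)=\{f\in L^2:(-\Delta)^{\alpha/2}f\in L^2\}$ with $\|f\|_{H^\alpha}=\|f\|_{L^2}+\|(-\Delta)^{\alpha/2}f\|_{L^2}$, and write $\|u(t)\|:=\|u(t,\cdot)\|_{H^\alpha}+\|\partial_t u(t,\cdot)\|_{L^2}$. Consider the Cauchy problem $$u_{tt}+(-\Delta)^\alpha u+m(x)u=0\ \text{ on }[0,T]\times\mathbb{R}^d,\qquad u(0)=u_0\in H^\alpha(\mathbb{R}^d),\quad u_t(0)=u_1\in L^2(\mathbb{R}^d),\tag{1}$$ where the mass $m$ is a real distribution on $\mathbb{R}^d$ or, more generally, a formal expression built from real distributions by sums and products (such as $\delta^2$). Let $\psi\in C_0^\infty(\mathbb{R}^d)$ be a Friedrichs mollifier, i.e. $\psi\ge 0$ and $\int\psi=1$, and let $\psi_\varepsilon(x)=\varepsilon^{-d}\psi(x/\varepsilon)$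 for $\varepsilon\in(0,1]$. The regularisation $(m_\varepsilon)_{\varepsilon\in(0,1]}$ of $m$ by $\psi$ is $m_\varepsilon=m*\psi_\varepsilon$ if $m$ is a distribution; sums and products are regularised term by term and factor by factor (so $\delta^2$ has the regularisation $\psi_\varepsilon^2$). A function $u\in C([0,T];H^\alpha)\cap C^1([0,T];L^2)$ is a solution of (1) with a bounded mass $\mu$ in place of $m$ if $u(0)=u_0$, $u_t(0)=u_1$, and for every $\varphi\in H^\alpha$ and every $t\in[0,T]$ $$\frac{d}{dt}\langle u_t(t),\varphi\rangle_{L^2}+\langle(-\Delta)^{\alpha/2}u(t),(-\Delta)^{\alpha/2}\varphi\rangle_{L^2}+\langle\mu u(t),\varphi\rangle_{L^2}=0 .$$ A net $(u_\varepsilon)_{\varepsilon\in(0,1]}$ in $C([0,T];H^\alpha)\cap C^1([0,T];L^2)$ is a very weak solution of (1) if * for some Friedrichs mollifier, with regularisation $(m_\varepsilon)$ of $m$, the net $(m_\varepsilon)$ is $L^\infty$-moderate (there are $N\in\mathbb{N}_0$ and $c>0$ with $\|m_\varepsilon\|_{L^\infty}\le c\,\varepsilon^{-N}$ for all $\varepsilon\in(0,1]$),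 and for every $\varepsilon\in(0,1]$ the function $u_\varepsilon$ is a solution of (1) with $m_\varepsilon$ in place of $m$; and * $(u_\varepsilon)$ is $C^1$-moderate: there are $N\in\mathbb{N}_0$ and $c>0$ with $\sup_{t\in[0,T]}\|u_\varepsilon(t)\|\le c\,\varepsilon^{-N}$ for all $\varepsilon\in(0,1]$. **Theorem.** Let $(m_\varepsilon)$ be the regularisation of $m$ by a Friedrichs mollifier $\psi$. Suppose that $m_\varepsilon\ge 0$ for all $\varepsilon\in(0,1]$ and that there are $N_0\in\mathbb{N}_0$ and $C_0>0$ with $\|m_\varepsilon\|_{L^\infty}\le C_0\,\varepsilon^{-N_0}$ for all $\varepsilon\in(0,1]$. Then, for all $u_0\in H^\alpha(\mathbb{R}^d)$ and $u_1\in L^2(\mathbb{R}^d)$, the Cauchy problem (1) has a very weak solution $(u_\varepsilon)$. More precisely, it has one such that, for every $\varepsilon\in(0,1]$, $u_\varepsilon$ is a solution of (1) with this $m_\varepsilon$ in place of $m$, and such that for some $C>0$ $$\sup_{t\in[0,T]}\|u_\varepsilon(t)\|\le C\,\varepsilon^{-N_0/2}\qquad\text{for all }\varepsilon\in(0,1].$$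 -/

import Mathlib

open MeasureTheory Set Filter Topology
open scoped FourierTransform Distributions ENNReal ComplexConjugate

noncomputable section

namespace KleinGordon

/-- The space `ℝ^d` with its Euclidean norm. -/
abbrev Space (d : ℕ) : Type := EuclideanSpace ℝ (Fin d)

/-- The Hilbert space `L²(ℝ^d)` of complex-valued functions. -/
abbrev L2 (d : ℕ) : Type := Lp ℂ 2 (volume : Measure (Space d))

/-- The index set `(0, 1]` of the regularisation parameter. -/
abbrev Param : Type := Ioc (0 : ℝ) 1

/-! ### Fractional Laplacian and fractional Sobolev space -/

/-- The function `ξ ↦ (2π|ξ|)^{2s} f̂(ξ)`, where `f̂(ξ) = ∫ e^{-2πi⟨x,ξ⟩} f(x) dx`: the Fourier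
transform of `(-Δ)^s f`. -/
def fracSymbolMul {d : ℕ} (s : ℝ) (f : L2 d) : Space d → ℂ := fun ξ =>
  (((2 * Real.pi * ‖ξ‖) ^ (2 * s) : ℝ) : ℂ) * (𝓕 f : L2 d) ξ

open Classical in
/-- The fractional Laplacian `(-Δ)^s f` in `L²(ℝ^d)`, as a Fourier multiplier. It is used only for
`f` in its domain; outside of it, the value is the default `0`. -/
def fracLaplacian {d : ℕ} (s : ℝ) (f : L2 d) : L2 d :=
  if h : MemLp (fracSymbolMul s f) 2 volume then 𝓕⁻ (h.toLp (fracSymbolMul s f)) else 0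

/-- `f ∈ H^α(ℝ^d)`: `f ∈ L²(ℝ^d)` and `(-Δ)^{α/2} f ∈ L²(ℝ^d)`. -/
def MemH {d : ℕ} (α : ℝ) (f : L2 d) : Prop :=
  MemLp (fracSymbolMul (α / 2) f) 2 volume

/-- `‖f‖_{H^α} = ‖f‖_{L²} + ‖(-Δ)^{α/2} f‖_{L²}`, for `f ∈ H^α`. -/
def normH {d : ℕ} (α : ℝ) (f : L2 d) : ℝ :=
  ‖f‖ + ‖fracLaplacian (α / 2) f‖

/-- `u ∈ C([0, T]; H^α(ℝ^d))`. -/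
def ContinuousInH {d : ℕ} (α T : ℝ) (u : ℝ → L2 d) : Prop :=
  (∀ t ∈ Icc 0 T, MemH α (u t)) ∧
    ∀ t ∈ Icc 0 T, Tendsto (fun s => normH α (u s - u t)) (𝓝[Icc 0 T] t) (𝓝 0)

/-! ### The Cauchy problem with a bounded mass -/

/-- The time derivative `∂ₜu` on `[0, T]` (one-sided at the end points). -/
def timeDeriv {d : ℕ} (T : ℝ) (u : ℝ → L2 d) (t : ℝ) : L2 d :=
  derivWithin u (Icc 0 T) t

/-- `‖u(t,·)‖ = ‖u(t,·)‖_{H^α} + ‖∂ₜu(t,·)‖_{L²}`. -/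
def energyNorm {d : ℕ} (α T : ℝ) (u : ℝ → L2 d) (t : ℝ) : ℝ :=
  normH α (u t) + ‖timeDeriv T u t‖

/-- `u ∈ C([0, T]; H^α) ∩ C¹([0, T]; L²)` solves
`u_tt + (-Δ)^α u + μ u = 0` on `[0, T] × ℝ^d`, `u(0) = u₀`, `u_t(0) = u₁`.
Here `u_tt` and `(-Δ)^α u` lie in the dual of `H^α` only, so that the equation is tested
against every `φ ∈ H^α`:
`d/dt ⟨φ, u_t⟩ + ⟨(-Δ)^{α/2} φ, (-Δ)^{α/2} u⟩ + ⟨φ, μ u⟩ = 0` for every `t ∈ [0, T]`. -/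
structure IsSolution {d : ℕ} (α T : ℝ) (μ : Space d → ℝ) (u₀ u₁ : L2 d) (u : ℝ → L2 d) :
    Prop where
  continuousInH : ContinuousInH α T u
  contDiffOn : ContDiffOn ℝ 1 u (Icc 0 T)
  equation : ∀ φ : L2 d, MemH α φ → ∀ t ∈ Icc 0 T,
    HasDerivWithinAt (fun s => inner ℂ φ (timeDeriv T u s))
      (-(inner ℂ (fracLaplacian (α / 2) φ) (fracLaplacian (α / 2) (u t)))
        - ∫ x, conj (φ x) * ((μ x : ℂ) * u t x))
      (Icc 0 T) t
  initial_value : u 0 = u₀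
  initial_velocity : timeDeriv T u 0 = u₁

/-! ### Singular masses and their regularisations -/

/-- A Friedrichs mollifier: `ψ ∈ C_0^∞(ℝ^d)`, `ψ ≥ 0`, `∫ ψ = 1`. -/
structure IsMollifier {d : ℕ} (ψ : 𝓓((⊤ : TopologicalSpace.Opens (Space d)), ℝ)) : Prop where
  nonneg : ∀ x, 0 ≤ ψ x
  integral_eq_one : ∫ x, ψ x = 1

/-- The test function `y ↦ ψ_ε(x - y)`, where `ψ_ε(z) = ε^{-d} ψ(z / ε)`. -/
def mollifierAt {d : ℕ} (ψ : 𝓓((⊤ : TopologicalSpace.Opens (Space d)), ℝ)) (ε : Param)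
    (x : Space d) : 𝓓((⊤ : TopologicalSpace.Opens (Space d)), ℝ) where
  toFun y := ((ε : ℝ) ^ d)⁻¹ * ψ ((ε : ℝ)⁻¹ • (x - y))
  contDiff' := contDiff_const.mul
    (ψ.contDiff.comp ((contDiff_const.sub contDiff_id).const_smul (ε : ℝ)⁻¹))
  hasCompactSupport' := by
    have hε : (ε : ℝ)⁻¹ ≠ 0 := inv_ne_zero ε.2.1.ne'
    have h : HasCompactSupport (fun y : Space d => ψ ((ε : ℝ)⁻¹ • (x - y))) :=
      ψ.hasCompactSupport.comp_homeomorph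
        ((Homeomorph.subLeft x).trans (Homeomorph.smulOfNeZero (ε : ℝ)⁻¹ hε))
    exact h.mul_left
  tsupport_subset' := fun _ _ => trivial

/-- Singular masses: real distributions on `ℝ^d`, and sums and products of such. The products,
such as `δ²`, are formal ones, and get their meaning from the regularisation, as in the
Colombeau algebra. -/
inductive SingularMass (d : ℕ) : Type
  | ofDistribution (S : 𝓓'((⊤ : TopologicalSpace.Opens (Space d)), ℝ)) : SingularMass d
  | add (m n : SingularMass d) : SingularMass d
  | mul (m n : SingularMass d) : SingularMass d

/-- The regularisation `m_ε` by means of `ψ`: for a distribution it is the convolution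
`m_ε(x) = (m ∗ ψ_ε)(x) = ⟨m, ψ_ε(x - ·)⟩`, and sums and products are regularised term by term and
factor by factor. -/
def SingularMass.regularise {d : ℕ} (ψ : 𝓓((⊤ : TopologicalSpace.Opens (Space d)), ℝ)) :
    SingularMass d → Param → Space d → ℝ
  | .ofDistribution S, ε, x => S (mollifierAt ψ ε x)
  | .add m n, ε, x => m.regularise ψ ε x + n.regularise ψ ε x
  | .mul m n, ε, x => m.regularise ψ ε x * n.regularise ψ ε x

/-! ### Moderateness and very weak solutions -/

/-- `g_ε ∈ L^∞(ℝ^d)` and `‖g_ε‖_{L^∞} ≤ c ε^{-N}` for all `ε ∈ (0, 1]`. -/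
def LInftyBound {d : ℕ} (g : Param → Space d → ℝ) (N : ℕ) (c : ℝ) : Prop :=
  ∀ ε : Param, MemLp (g ε) ∞ volume ∧
    eLpNorm (g ε) ∞ volume ≤ ENNReal.ofReal (c * (ε : ℝ) ^ (-(N : ℝ)))

/-- The net `(g_ε)` is `L^∞`-moderate. -/
def LInftyModerate {d : ℕ} (g : Param → Space d → ℝ) : Prop :=
  ∃ N : ℕ, ∃ c : ℝ, 0 < c ∧ LInftyBound g N c

/-- The net `(u_ε)` is `C¹`-moderate: `sup_{t ∈ [0, T]} ‖u_ε(t,·)‖ ≤ c ε^{-N}`. -/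
def C1Moderate {d : ℕ} (α T : ℝ) (u : Param → ℝ → L2 d) : Prop :=
  ∃ N : ℕ, ∃ c : ℝ, 0 < c ∧ ∀ ε : Param, ∀ t ∈ Icc 0 T,
    energyNorm α T (u ε) t ≤ c * (ε : ℝ) ^ (-(N : ℝ))

/-- The net `(u_ε)` is a very weak solution of
`u_tt + (-Δ)^α u + m u = 0`, `u(0) = u₀`, `u_t(0) = u₁`. -/
def IsVeryWeakSolution {d : ℕ} (α T : ℝ) (m : SingularMass d) (u₀ u₁ : L2 d)
    (u : Param → ℝ → L2 d) : Prop :=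
  (∃ ψ : 𝓓((⊤ : TopologicalSpace.Opens (Space d)), ℝ), IsMollifier ψ ∧
      LInftyModerate (m.regularise ψ) ∧
      ∀ ε : Param, IsSolution α T (m.regularise ψ ε) u₀ u₁ (u ε)) ∧
    C1Moderate α T u

end KleinGordon

end

namespace KleinGordon

/-! ### Global solutions of Lipschitz differential equations -/

section LipschitzODE

variable {E : Type*} [NormedAddCommGroup E]

/-! For fixed `ε` the mass is bounded and nonnegative, and with `A = (-Δ)^{α/2}` and `M`
multiplication by the mass the equation reads `u'' + A² u + M u = 0`. The energy `‖u'‖² + ‖A u‖² +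
⟨u, M u⟩` is conserved. Its last term is nonnegative at every time and at time `0` is at most
`‖m_ε‖_∞ ‖u₀‖²`. Hence `‖u'‖` and `‖A u‖` are `O(ε^{-N₀/2})`, and integrating `u'` bounds `‖u‖` in
the same way.

Existence rests on removing the unbounded `A`. The vectors `p = u' + i A u` and `q = u' - i A u`
formally satisfy `p' = i A p - M u` and `q' = -i A q - M u`. Undoing the unitary groups `e^{±itA}`
turns this into a globally Lipschitz differential equation (`exists_interaction_picture`), which is
solved by a contraction (`exists_solution_of_lipschitz`). `exists_wave` then recovers `A u` from `p
- q` by self-adjointness, and proves conservation of energy. Self-adjointness of `A` comes from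
Plancherel and the case of a multiplication operator (`isSelfAdjointGenerator_mulOp`). -/

theorem continuous_comp_of_lipschitz {f : ℝ → E → E} {K : NNReal}
    (hlip : ∀ t, LipschitzWith K (f t)) (hcont : ∀ x, Continuous fun t => f t x)
    {y : ℝ → E} (hy : Continuous y) : Continuous fun t => f t (y t) := by
  rw [continuous_iff_continuousAt]
  intro t
  have h1 : Tendsto (fun s => f s (y t)) (𝓝 t) (𝓝 (f t (y t))) := (hcont (y t)).continuousAt
  have h2 : Tendsto (fun s => (K : ℝ) * dist (y s) (y t)) (𝓝 t) (𝓝 0) := by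
    have := (hy.continuousAt (x := t)).dist (tendsto_const_nhds (x := y t))
    simpa using this.const_mul (K : ℝ)
  refine h1.congr_dist (squeeze_zero (fun _ => dist_nonneg) (fun s => ?_) h2)
  rw [dist_comm]
  exact (hlip s).dist_le_mul _ _

variable [NormedSpace ℝ E] [CompleteSpace E]

/-- The gain of the factor `1 / l` makes the Picard map a contraction in an exponentially weighted
norm, whatever the length of the interval. -/
theorem integral_mul_exp_le {l : ℝ} (hl : 0 < l) (t : ℝ) (c : ℝ) (hc : 0 ≤ c) :
    ∫ s in (0 : ℝ)..t, c * Real.exp (l * s) ≤ c / l * Real.exp (l * t) := by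
  have h : ∀ s ∈ uIcc 0 t, HasDerivAt (fun s => c / l * Real.exp (l * s))
      (c * Real.exp (l * s)) s := fun s _ => by
    have h1 : HasDerivAt (fun s => l * s) l s := by simpa using (hasDerivAt_id s).const_mul l
    have h2 : c * Real.exp (l * s) = c / l * (Real.exp (l * s) * l) := by field_simp
    rw [h2]
    exact h1.exp.const_mul (c / l)
  rw [intervalIntegral.integral_eq_sub_of_hasDerivAt h
    (Continuous.intervalIntegrable (by fun_prop) _ _)]
  have : 0 ≤ c / l * Real.exp (l * 0) := by positivity
  linarith

/-- A differential equation whose right-hand side is globally Lipschitz in the space variable,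
uniformly in time, has a solution on every interval `[0, T]`. -/
theorem exists_solution_of_lipschitz {f : ℝ → E → E} {K : NNReal}
    (hlip : ∀ t, LipschitzWith K (f t)) (hcont : ∀ x, Continuous fun t => f t x)
    {T : ℝ} (hT : 0 ≤ T) (x₀ : E) :
    ∃ y : ℝ → E, y 0 = x₀ ∧ Continuous y ∧ ∀ t ∈ Icc 0 T, HasDerivAt y (f t (y t)) t := by
  -- The unknown is `z = e^{-lt} y`, so that the sup norm of `z` is a weighted norm of `y`. The
  -- contraction constant is `K / l ≤ 1 / 2`; the `+ 1` keeps `l` positive when `K = 0`.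
  set l : ℝ := 2 * K + 1 with hl_def
  have hl : 0 < l := by positivity
  -- Extending `z` by constants to all of `ℝ` makes the integrand continuous everywhere, which gives
  -- two-sided derivatives even at `0` and `T`.
  let ext (z : C(Icc 0 T, E)) : ℝ → E := fun s => Real.exp (l * s) • IccExtend hT z s
  have hext (z : C(Icc 0 T, E)) : Continuous (ext z) :=
    (by fun_prop : Continuous fun s : ℝ => Real.exp (l * s)).smul (z.continuous.Icc_extend' (h := hT))
  have hF (z : C(Icc 0 T, E)) : Continuous fun s => f s (ext z s) :=
    continuous_comp_of_lipschitz hlip hcont (hext z)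
  let y (z : C(Icc 0 T, E)) : ℝ → E := fun t => x₀ + ∫ s in (0 : ℝ)..t, f s (ext z s)
  have hy (z : C(Icc 0 T, E)) (t : ℝ) : HasDerivAt (y z) (f t (ext z t)) t :=
    ((hF z).integral_hasStrictDerivAt 0 t).hasDerivAt.const_add x₀
  have hyc (z : C(Icc 0 T, E)) : Continuous (y z) :=
    continuous_iff_continuousAt.2 fun t => (hy z t).continuousAt
  let Φ (z : C(Icc 0 T, E)) : C(Icc 0 T, E) :=
    ⟨fun t => Real.exp (-(l * t)) • y z t,
      (by fun_prop : Continuous fun t : Icc 0 T => Real.exp (-(l * t))).smul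
        ((hyc z).comp continuous_subtype_val)⟩
  have hΦ : ContractingWith (1 / 2) Φ := by
    refine ⟨by norm_num, LipschitzWith.of_dist_le_mul fun z w => ?_⟩
    rw [ContinuousMap.dist_le (by positivity)]
    intro t
    have ht : (0 : ℝ) ≤ t := t.2.1
    have hpt : ∀ s, ‖f s (ext z s) - f s (ext w s)‖ ≤ (K * dist z w) * Real.exp (l * s) := by
      intro s
      rw [← dist_eq_norm]
      refine ((hlip s).dist_le_mul _ _).trans ?_
      have h1 : dist (ext z s) (ext w s) ≤ Real.exp (l * s) * dist z w := by
        simp only [ext, dist_smul₀, Real.norm_eq_abs, Real.abs_exp]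
        gcongr
        exact ContinuousMap.dist_apply_le_dist _
      calc (K : ℝ) * dist (ext z s) (ext w s) ≤ K * (Real.exp (l * s) * dist z w) := by gcongr
        _ = _ := by ring
    have hint : ‖y z t - y w t‖ ≤ (K * dist z w) / l * Real.exp (l * t) := by
      have : y z t - y w t = ∫ s in (0 : ℝ)..t, (f s (ext z s) - f s (ext w s)) := by
        rw [intervalIntegral.integral_sub ((hF z).intervalIntegrable _ _)
          ((hF w).intervalIntegrable _ _)]
        simp [y]
      rw [this]
      refine (intervalIntegral.norm_integral_le_of_norm_le ht
        (Eventually.of_forall fun s _ => hpt s)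
        (Continuous.intervalIntegrable (by fun_prop) _ _)).trans ?_
      exact integral_mul_exp_le hl _ _ (by positivity)
    have h1 : dist (Φ z t) (Φ w t) = Real.exp (-(l * t)) * ‖y z t - y w t‖ := by
      simp only [Φ, dist_eq_norm, ContinuousMap.coe_mk]
      rw [← smul_sub, norm_smul, Real.norm_eq_abs, Real.abs_exp]
    rw [h1]
    calc Real.exp (-(l * t)) * ‖y z t - y w t‖
        ≤ Real.exp (-(l * t)) * ((K * dist z w) / l * Real.exp (l * t)) := by gcongr
      _ = (K / l) * dist z w := by
        rw [Real.exp_neg]; field_simp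
      _ ≤ ((1 / 2 : NNReal) : ℝ) * dist z w := by
        gcongr
        rw [div_le_iff₀ hl, hl_def]
        push_cast
        linarith
  set z := hΦ.fixedPoint Φ
  have hz : Φ z = z := hΦ.fixedPoint_isFixedPt
  refine ⟨y z, by simp [y], hyc z, fun t ht => ?_⟩
  have : ext z t = y z t := by
    have h2 : z ⟨t, ht⟩ = Real.exp (-(l * t)) • y z t := by
      conv_lhs => rw [← hz]
      rfl
    simp only [ext, IccExtend_of_mem hT _ ht, h2, smul_smul, ← Real.exp_add]
    simp
  rw [← this]
  exact hy z t

end LipschitzODE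

/-! ### The abstract wave equation `u'' + A² u + M u = 0` -/

section AbstractWave

variable {H : Type*} [NormedAddCommGroup H] [InnerProductSpace ℂ H]
  [NormedSpace ℝ H]

/-- The operator `A` with domain `D` is self-adjoint and `U t = exp (i t A)`. -/
structure IsSelfAdjointGenerator (U : ℝ → H →L[ℂ] H) (D : H → Prop) (A : H → H) : Prop where
  map_zero : ∀ x, U 0 x = x
  apply_neg_apply : ∀ t x, U t (U (-t) x) = x
  inner_left : ∀ t x y, inner ℂ (U t x) y = inner ℂ x (U (-t) y)
  continuous : ∀ x, Continuous fun t => U t x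
  hasDerivAt : ∀ x, D x → ∀ t, HasDerivAt (fun t => U t x) (Complex.I • U t (A x)) t
  inner_symm : ∀ x y, D x → D y → inner ℂ (A x) y = inner ℂ x (A y)
  mem_of_forall_inner : ∀ u w, (∀ x, D x → inner ℂ x w = inner ℂ (A x) u) → D u ∧ A u = w

namespace IsSelfAdjointGenerator

variable {U : ℝ → H →L[ℂ] H} {D : H → Prop} {A : H → H}

theorem neg_apply_apply (hU : IsSelfAdjointGenerator U D A) (t : ℝ) (x : H) :
    U (-t) (U t x) = x := by
  simpa using hU.apply_neg_apply (-t) x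

theorem inner_map_map (hU : IsSelfAdjointGenerator U D A) (t : ℝ) (x y : H) :
    inner ℂ (U t x) (U t y) = inner ℂ x y := by
  rw [hU.inner_left, hU.neg_apply_apply]

theorem norm_map (hU : IsSelfAdjointGenerator U D A) (t : ℝ) (x : H) : ‖U t x‖ = ‖x‖ := by
  rw [@norm_eq_sqrt_re_inner ℂ, hU.inner_map_map, ← @norm_eq_sqrt_re_inner ℂ]

theorem lipschitzWith (hU : IsSelfAdjointGenerator U D A) (t : ℝ) :
    LipschitzWith 1 fun x => U t x :=
  LipschitzWith.of_dist_le_mul fun x y => by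
    rw [dist_eq_norm, ← map_sub, hU.norm_map, dist_eq_norm]; simp

theorem continuous_apply (hU : IsSelfAdjointGenerator U D A) {y : ℝ → H} (hy : Continuous y) :
    Continuous fun t => U t (y t) :=
  continuous_comp_of_lipschitz (f := fun t x => U t x) hU.lipschitzWith hU.continuous hy

theorem continuous_neg_apply (hU : IsSelfAdjointGenerator U D A) {y : ℝ → H}
    (hy : Continuous y) : Continuous fun t => U (-t) (y t) :=
  continuous_comp_of_lipschitz (f := fun t x => U (-t) x) (fun t => hU.lipschitzWith (-t))
    (fun x => (hU.continuous x).comp continuous_neg) hy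

/-- Linearity of `A` is not assumed: it follows from symmetry and maximality of the domain. -/
theorem sub_mem (hU : IsSelfAdjointGenerator U D A) {x y : H} (hx : D x) (hy : D y) :
    D (x - y) ∧ A (x - y) = A x - A y := by
  refine hU.mem_of_forall_inner _ _ fun z hz => ?_
  rw [inner_sub_right, inner_sub_right, hU.inner_symm z x hz hx, hU.inner_symm z y hz hy]

/-- The wave equation in the interaction picture: with `v = u'`, `P = e^{-itA} (v + i A u)` and
`Q = e^{itA} (v - i A u)` it is an ordinary differential equation. -/
theorem exists_interaction_picture [CompleteSpace H] (hU : IsSelfAdjointGenerator U D A)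
    (M : H →L[ℂ] H) {T : ℝ} (hT : 0 ≤ T) (u₀ P₀ Q₀ : H) :
    ∃ u P Q : ℝ → H, u 0 = u₀ ∧ P 0 = P₀ ∧ Q 0 = Q₀ ∧
      Continuous u ∧ Continuous P ∧ Continuous Q ∧
      ∀ t ∈ Icc 0 T, HasDerivAt u ((1 / 2 : ℂ) • (U t (P t) + U (-t) (Q t))) t ∧
        HasDerivAt P (-U (-t) (M (u t))) t ∧ HasDerivAt Q (-U t (M (u t))) t := by
  -- Only the isometries `U (±t)` and the bounded `M` occur here, so the Lipschitz constant `1 +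
  -- ‖M‖` does not depend on `t`.
  let f : ℝ → H × H × H → H × H × H := fun t Y =>
    ((1 / 2 : ℂ) • (U t Y.2.1 + U (-t) Y.2.2), -U (-t) (M Y.1), -U t (M Y.1))
  have hlip : ∀ t, LipschitzWith (1 + ‖M‖₊) (f t) := by
    intro t
    refine LipschitzWith.of_dist_le_mul fun Y Z => ?_
    rw [dist_eq_norm, dist_eq_norm]
    have h1 : ‖Y.1 - Z.1‖ ≤ ‖Y - Z‖ := norm_fst_le (Y - Z)
    have h2 : ‖Y.2.1 - Z.2.1‖ ≤ ‖Y - Z‖ :=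
      (norm_fst_le (Y - Z).2).trans (norm_snd_le (Y - Z))
    have h3 : ‖Y.2.2 - Z.2.2‖ ≤ ‖Y - Z‖ :=
      (norm_snd_le (Y - Z).2).trans (norm_snd_le (Y - Z))
    have hM : ∀ s, ‖-U s (M Y.1) - -U s (M Z.1)‖ ≤ (1 + ‖M‖) * ‖Y - Z‖ := by
      intro s
      rw [← neg_sub', norm_neg, ← map_sub, hU.norm_map, ← map_sub]
      refine (M.le_opNorm _).trans ?_
      gcongr
      linarith
    have hv : ‖(1 / 2 : ℂ) • (U t Y.2.1 + U (-t) Y.2.2) -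
        (1 / 2 : ℂ) • (U t Z.2.1 + U (-t) Z.2.2)‖ ≤ (1 + ‖M‖) * ‖Y - Z‖ := by
      rw [← smul_sub, add_sub_add_comm, ← map_sub, ← map_sub, norm_smul]
      have h4 := norm_add_le (U t (Y.2.1 - Z.2.1)) (U (-t) (Y.2.2 - Z.2.2))
      rw [hU.norm_map, hU.norm_map] at h4
      have h5 : ‖(1 / 2 : ℂ)‖ = 1 / 2 := by norm_num
      rw [h5]
      nlinarith [mul_nonneg (norm_nonneg M) (norm_nonneg (Y - Z))]
    exact max_le hv (max_le (hM _) (hM _))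
  have hcont : ∀ Y, Continuous fun t => f t Y := fun Y =>
    (((hU.continuous _).add (hU.continuous_neg_apply continuous_const)).const_smul _).prodMk
      ((hU.continuous_neg_apply continuous_const).neg.prodMk (hU.continuous _).neg)
  obtain ⟨Y, hY0, hYc, hY⟩ := exists_solution_of_lipschitz hlip hcont hT (u₀, P₀, Q₀)
  refine ⟨fun t => (Y t).1, fun t => (Y t).2.1, fun t => (Y t).2.2, by simp [hY0], by simp [hY0],
    by simp [hY0], by fun_prop, by fun_prop, by fun_prop, fun t ht => ?_⟩
  have h := hY t ht
  have hsnd : HasDerivAt (fun t => (Y t).2) (f t (Y t)).2 t :=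
    (ContinuousLinearMap.snd ℝ H (H × H)).hasFDerivAt.comp_hasDerivAt t h
  exact ⟨(ContinuousLinearMap.fst ℝ H (H × H)).hasFDerivAt.comp_hasDerivAt t h,
    (ContinuousLinearMap.fst ℝ H H).hasFDerivAt.comp_hasDerivAt t hsnd,
    (ContinuousLinearMap.snd ℝ H H).hasFDerivAt.comp_hasDerivAt t hsnd⟩

/-- The weak form of `p' = i A p - g` for `p = e^{itA} P` and `P' = -e^{-itA} g`. -/
theorem hasDerivAt_inner (hU : IsSelfAdjointGenerator U D A) {P : ℝ → H} {g : H} {t : ℝ}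
    (hP : HasDerivAt P (-U (-t) g) t) {x : H} (hx : D x) :
    HasDerivAt (fun s => inner ℂ x (U s (P s)))
      (Complex.I * inner ℂ (A x) (U t (P t)) - inner ℂ x g) t := by
  -- The group is moved onto `x`, whose orbit is differentiable because `x` lies in the domain; `P
  -- t` need not lie there.
  have h1 : HasDerivAt (fun s => U (-s) x) (-(Complex.I • U (-t) (A x))) t := by
    have := (hU.hasDerivAt x hx (-t)).scomp t (hasDerivAt_neg t)
    simpa [Function.comp_def] using this
  have h2 := h1.inner ℂ hP
  have h3 : (fun s => inner ℂ x (U s (P s))) = fun s => inner ℂ (U (-s) x) (P s) := by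
    funext s; rw [hU.inner_left, neg_neg]
  rw [h3]
  refine h2.congr_deriv ?_
  rw [inner_neg_right, hU.inner_map_map, inner_neg_left, inner_smul_left, hU.inner_left, neg_neg]
  simp
  ring

/-- The weak form of `q' = -i A q - g` for `q = e^{-itA} Q` and `Q' = -e^{itA} g`. -/
theorem hasDerivAt_inner_neg (hU : IsSelfAdjointGenerator U D A) {Q : ℝ → H} {g : H} {t : ℝ}
    (hQ : HasDerivAt Q (-U t g) t) {x : H} (hx : D x) :
    HasDerivAt (fun s => inner ℂ x (U (-s) (Q s)))
      (-(Complex.I * inner ℂ (A x) (U (-t) (Q t))) - inner ℂ x g) t := by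
  have h2 := (hU.hasDerivAt x hx t).inner ℂ hQ
  have h3 : (fun s => inner ℂ x (U (-s) (Q s))) = fun s => inner ℂ (U s x) (Q s) := by
    funext s; rw [hU.inner_left]
  rw [h3]
  refine h2.congr_deriv ?_
  rw [inner_neg_right, hU.inner_map_map, inner_smul_left, hU.inner_left]
  simp
  ring

theorem eq_of_hasDerivAt_zero {F : Type*} [NormedAddCommGroup F] [NormedSpace ℝ F] {f : ℝ → F}
    {T : ℝ} (hf : ∀ t ∈ Icc 0 T, HasDerivAt f 0 t) : ∀ t ∈ Icc 0 T, f t = f 0 :=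
  constant_of_has_deriv_right_zero (fun t ht => (hf t ht).continuousAt.continuousWithinAt)
    fun t ht => (hf t ⟨ht.1, ht.2.le⟩).hasDerivWithinAt

/-- Existence and conservation of energy for `u'' + A² u + M u = 0`, where `A` is self-adjoint and
`M` is bounded and symmetric. -/
theorem exists_wave [IsScalarTower ℝ ℂ H] [CompleteSpace H] (hU : IsSelfAdjointGenerator U D A)
    (M : H →L[ℂ] H) (hM : ∀ x y, inner ℂ (M x) y = inner ℂ x (M y))
    {T : ℝ} (hT : 0 ≤ T) {u₀ : H} (hu₀ : D u₀) (u₁ : H) :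
    ∃ u v : ℝ → H, u 0 = u₀ ∧ v 0 = u₁ ∧ Continuous v ∧
      (∀ t ∈ Icc 0 T, HasDerivAt u (v t) t) ∧
      (∀ t ∈ Icc 0 T, D (u t)) ∧ ContinuousOn (fun t => A (u t)) (Icc 0 T) ∧
      (∀ φ, D φ → ∀ t ∈ Icc 0 T, HasDerivAt (fun s => inner ℂ φ (v s))
        (-inner ℂ (A φ) (A (u t)) - inner ℂ φ (M (u t))) t) ∧
      ∀ t ∈ Icc 0 T, ‖v t‖ ^ 2 + ‖A (u t)‖ ^ 2 + (inner ℂ (u t) (M (u t))).re =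
        ‖u₁‖ ^ 2 + ‖A u₀‖ ^ 2 + (inner ℂ u₀ (M u₀)).re := by
  obtain ⟨u, P, Q, hu0, hP0, hQ0, huc, hPc, hQc, hd⟩ := hU.exists_interaction_picture M hT u₀
    (u₁ + Complex.I • A u₀) (u₁ - Complex.I • A u₀)
  let v : ℝ → H := fun t => (1 / 2 : ℂ) • (U t (P t) + U (-t) (Q t))
  -- `w` is the candidate for `A u`, obtained by solving `p = v + i w`, `q = v - i w`. At this stage
  -- `u t` is not known to lie in the domain.
  let w : ℝ → H := fun t => (-Complex.I / 2) • (U t (P t) - U (-t) (Q t))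
  have hv0 : v 0 = u₁ := by
    simp only [v, neg_zero, hU.map_zero, hP0, hQ0]
    module
  have hw0 : w 0 = A u₀ := by
    simp only [w, neg_zero, hU.map_zero, hP0, hQ0]
    rw [add_sub_sub_cancel, ← two_smul ℂ (Complex.I • A u₀), smul_smul, smul_smul]
    have : -Complex.I / 2 * 2 * Complex.I = 1 := by
      linear_combination -Complex.I_mul_I
    rw [this, one_smul]
  have hpc := hU.continuous_apply hPc
  have hqc := hU.continuous_neg_apply hQc
  have hvc : Continuous v := (hpc.add hqc).const_smul _
  have hwc : Continuous w := (hpc.sub hqc).const_smul _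
  have hdu : ∀ t ∈ Icc 0 T, HasDerivAt u (v t) t := fun t ht => (hd t ht).1
  have hdv : ∀ φ, D φ → ∀ t ∈ Icc 0 T, HasDerivAt (fun s => inner ℂ φ (v s))
      (-inner ℂ (A φ) (w t) - inner ℂ φ (M (u t))) t := by
    intro φ hφ t ht
    have h := ((hU.hasDerivAt_inner (hd t ht).2.1 hφ).add
      (hU.hasDerivAt_inner_neg (hd t ht).2.2 hφ)).const_mul (1 / 2 : ℂ)
    have h1 : (fun s => inner ℂ φ (v s)) = fun s =>
        (1 / 2 : ℂ) * (inner ℂ φ (U s (P s)) + inner ℂ φ (U (-s) (Q s))) := by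
      funext s; simp only [v, inner_smul_right, inner_add_right]
    rw [h1]
    refine h.congr_deriv ?_
    simp only [w, inner_smul_right, inner_sub_right]
    ring
  have hdw : ∀ φ, D φ → ∀ t ∈ Icc 0 T, HasDerivAt (fun s => inner ℂ φ (w s))
      (inner ℂ (A φ) (v t)) t := by
    intro φ hφ t ht
    have h := ((hU.hasDerivAt_inner (hd t ht).2.1 hφ).sub
      (hU.hasDerivAt_inner_neg (hd t ht).2.2 hφ)).const_mul (-Complex.I / 2)
    have h1 : (fun s => inner ℂ φ (w s)) = fun s =>
        (-Complex.I / 2) * (inner ℂ φ (U s (P s)) - inner ℂ φ (U (-s) (Q s))) := by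
      funext s; simp only [w, inner_smul_right, inner_sub_right]
    rw [h1]
    refine h.congr_deriv ?_
    simp only [v, inner_smul_right, inner_add_right]
    linear_combination (-(1 / 2 : ℂ) * (inner ℂ (A φ) (U t (P t)) +
      inner ℂ (A φ) (U (-t) (Q t)))) * Complex.I_mul_I
  -- Against each `φ` in the domain, `⟨φ, w⟩ - ⟨A φ, u⟩` has zero derivative and vanishes at `0`;
  -- self-adjointness then gives both claims.
  have hAu : ∀ t ∈ Icc 0 T, D (u t) ∧ A (u t) = w t := by
    intro t ht
    refine hU.mem_of_forall_inner _ _ fun φ hφ => ?_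
    have hc := eq_of_hasDerivAt_zero (T := T)
      (f := fun s => inner ℂ φ (w s) - inner ℂ (A φ) (u s)) (fun s hs => by
        have := (hdw φ hφ s hs).sub ((hasDerivAt_const s (A φ)).inner ℂ (hdu s hs))
        refine this.congr_deriv ?_
        simp) t ht
    have h0 : inner ℂ φ (w 0) - inner ℂ (A φ) (u 0) = 0 := by
      rw [hw0, hu0, hU.inner_symm φ u₀ hφ hu₀, sub_self]
    exact sub_eq_zero.1 (hc.trans h0)
  refine ⟨u, v, hu0, hv0, hvc, hdu, fun t ht => (hAu t ht).1,
    hwc.continuousOn.congr fun t ht => (hAu t ht).2, fun φ hφ t ht => ?_, fun t ht => ?_⟩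
  · rw [(hAu t ht).2]
    exact hdv φ hφ t ht
  -- The derivatives of `v` and `w` are available only in weak form, so the energy is not
  -- differentiated directly. The parallelogram law and unitarity express it through `P` and `Q`,
  -- which are differentiable in norm.
  · have hpar : ∀ s, ‖v s‖ ^ 2 + ‖w s‖ ^ 2 =
        (1 / 2) * ((inner ℂ (P s) (P s)).re + (inner ℂ (Q s) (Q s)).re) := by
      intro s
      have h := parallelogram_law_with_norm ℂ (U s (P s)) (U (-s) (Q s))
      have hPs : (inner ℂ (P s) (P s)).re = ‖P s‖ ^ 2 := by
        simpa using inner_self_eq_norm_sq (𝕜 := ℂ) (P s)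
      have hQs : (inner ℂ (Q s) (Q s)).re = ‖Q s‖ ^ 2 := by
        simpa using inner_self_eq_norm_sq (𝕜 := ℂ) (Q s)
      rw [hU.norm_map, hU.norm_map] at h
      simp only [v, w, norm_smul, hPs, hQs]
      norm_num
      linarith
    have hE : ∀ s ∈ Icc 0 T, HasDerivAt (fun s => (1 / 2) * ((inner ℂ (P s) (P s)).re +
        (inner ℂ (Q s) (Q s)).re) + (inner ℂ (u s) (M (u s))).re) 0 s := by
      intro s hs
      obtain ⟨h1, h2, h3⟩ := hd s hs
      have hMu : HasDerivAt (fun s => M (u s)) (M (v s)) s :=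
        (M.restrictScalars ℝ).hasFDerivAt.comp_hasDerivAt s h1
      have hre : ∀ {f : ℝ → ℂ} {f' : ℂ}, HasDerivAt f f' s →
          HasDerivAt (fun s => (f s).re) f'.re s := fun hf =>
        Complex.reCLM.hasFDerivAt.comp_hasDerivAt s hf
      have h := (((hre (h2.inner ℂ h2)).add (hre (h3.inner ℂ h3))).const_mul (1 / 2 : ℝ)).add
        (hre (h1.inner ℂ hMu))
      refine h.congr_deriv ?_
      have e1 : (inner ℂ (P s) (U (-s) (M (u s)))).re = (inner ℂ (U s (P s)) (M (u s))).re := by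
        rw [hU.inner_left]
      have e2 : (inner ℂ (Q s) (U s (M (u s)))).re = (inner ℂ (U (-s) (Q s)) (M (u s))).re := by
        rw [hU.inner_left, neg_neg]
      have e3 : (inner ℂ (u s) (M (v s))).re = (inner ℂ (v s) (M (u s))).re := by
        rw [← hM]; exact inner_re_symm (𝕜 := ℂ) _ _
      have e4 : (inner ℂ (v s) (M (u s))).re = (1 / 2) * ((inner ℂ (U s (P s)) (M (u s))).re +
          (inner ℂ (U (-s) (Q s)) (M (u s))).re) := by
        simp only [v, inner_smul_left, inner_add_left]
        simp
      have e5 : (inner ℂ (U (-s) (M (u s))) (P s)).re = (inner ℂ (P s) (U (-s) (M (u s)))).re :=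
        inner_re_symm (𝕜 := ℂ) _ _
      have e6 : (inner ℂ (U s (M (u s))) (Q s)).re = (inner ℂ (Q s) (U s (M (u s)))).re :=
        inner_re_symm (𝕜 := ℂ) _ _
      simp only [Complex.add_re, inner_neg_left, inner_neg_right, Complex.neg_re]
      change _ + ((inner ℂ (u s) (M (v s))).re + (inner ℂ (v s) (M (u s))).re) = 0
      linarith
    have hc := eq_of_hasDerivAt_zero hE t ht
    simp only [← hpar] at hc
    rw [(hAu t ht).2, hc, hv0, hw0, hu0]

end IsSelfAdjointGenerator

end AbstractWave

noncomputable section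

/-! ### Multiplication operators on `L²` -/

section Multiplication

variable {X : Type*} [MeasurableSpace X] {μ : Measure X}

theorem norm_sq_eq_integral (f : Lp ℂ 2 μ) : ‖f‖ ^ 2 = ∫ x, ‖f x‖ ^ 2 ∂μ := by
  have h : (inner ℂ f f : ℂ) = ∫ x, ((‖f x‖ ^ 2 : ℝ) : ℂ) ∂μ := by
    rw [L2.inner_def]
    congr 1
    funext x
    rw [inner_self_eq_norm_sq_to_K]
    norm_cast
  rw [integral_complex_ofReal, inner_self_eq_norm_sq_to_K] at h
  have hre := congrArg Complex.re h
  norm_cast at hre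

/-- Dominated convergence in `L²`. -/
theorem tendsto_L2_of_dominated {ι : Type*} {l : Filter ι} [l.IsCountablyGenerated]
    {F : ι → Lp ℂ 2 μ} {G : Lp ℂ 2 μ} {φ : ι → X → ℂ} {b : X → ℝ} (hb : MemLp b 2 μ)
    (hF : ∀ n, F n =ᵐ[μ] φ n) (hle : ∀ᶠ n in l, ∀ᵐ x ∂μ, ‖φ n x‖ ≤ b x)
    (hlim : ∀ᵐ x ∂μ, Tendsto (fun n => φ n x) l (𝓝 (G x))) : Tendsto F l (𝓝 G) := by
  rw [tendsto_iff_norm_sub_tendsto_zero]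
  have hnorm : ∀ n, ‖F n - G‖ ^ 2 = ∫ x, ‖φ n x - G x‖ ^ 2 ∂μ := by
    intro n
    rw [norm_sq_eq_integral]
    refine integral_congr_ae ?_
    filter_upwards [hF n, Lp.coeFn_sub (F n) G] with x h2 h3
    rw [h3, Pi.sub_apply, h2]
  have hsq : Tendsto (fun n => ‖F n - G‖ ^ 2) l (𝓝 0) := by
    have hint : Integrable (fun x => (b x + ‖G x‖) ^ 2) μ :=
      (hb.add (Lp.memLp G).norm).integrable_sq
    have h0 : (∫ _, (0 : ℝ) ∂μ) = 0 := by simp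
    simp only [hnorm]
    rw [← h0]
    refine tendsto_integral_filter_of_dominated_convergence (fun x => (b x + ‖G x‖) ^ 2)
      (Eventually.of_forall fun n => ?_) ?_ hint ?_
    · exact ((((Lp.aestronglyMeasurable (F n)).congr (hF n)).sub
        (Lp.aestronglyMeasurable G)).norm.pow 2)
    · filter_upwards [hle] with n hn
      filter_upwards [hn] with x h1
      rw [Real.norm_of_nonneg (by positivity)]
      gcongr
      exact (norm_sub_le _ _).trans (by gcongr)
    · filter_upwards [hlim] with x hx
      simpa using ((hx.sub_const (G x)).norm).pow 2
  have := hsq.sqrt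
  simpa [Real.sqrt_sq] using this

/-- Multiplication by an essentially bounded function, as an operator on `L²`. -/
def mulL2 (g : X → ℂ) (hg : MemLp g ∞ μ) : Lp ℂ 2 μ →L[ℂ] Lp ℂ 2 μ :=
  (ContinuousLinearMap.mul ℂ ℂ).holderL μ ∞ 2 2 (hg.toLp g)

theorem coeFn_mulL2 (g : X → ℂ) (hg : MemLp g ∞ μ) (f : Lp ℂ 2 μ) :
    mulL2 g hg f =ᵐ[μ] fun x => g x * f x := by
  filter_upwards [(ContinuousLinearMap.mul ℂ ℂ).coeFn_holder (r := 2) (hg.toLp g) f,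
    hg.coeFn_toLp] with x h1 h2
  have h3 : (mulL2 g hg f : X → ℂ) x = ContinuousLinearMap.mul ℂ ℂ (hg.toLp g x) (f x) := h1
  rw [h3, h2, ContinuousLinearMap.mul_apply']

theorem inner_eq_integral_of_ae {f g : Lp ℂ 2 μ} {φ γ : X → ℂ} (hf : f =ᵐ[μ] φ)
    (hg : g =ᵐ[μ] γ) : (inner ℂ f g : ℂ) = ∫ x, conj (φ x) * γ x ∂μ := by
  rw [L2.inner_def]
  refine integral_congr_ae ?_
  filter_upwards [hf, hg] with x h1 h2
  rw [h1, h2, RCLike.inner_apply, mul_comm]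

theorem inner_mulL2 (g : X → ℂ) (hg : MemLp g ∞ μ) (h : X → ℂ) (hh : MemLp h ∞ μ)
    (hgh : ∀ x, conj (g x) = h x) (f₁ f₂ : Lp ℂ 2 μ) :
    inner ℂ (mulL2 g hg f₁) f₂ = inner ℂ f₁ (mulL2 h hh f₂) := by
  rw [inner_eq_integral_of_ae (coeFn_mulL2 g hg f₁) (ae_eq_refl _),
    inner_eq_integral_of_ae (ae_eq_refl _) (coeFn_mulL2 h hh f₂)]
  congr 1
  funext x
  rw [map_mul, hgh]
  ring

/-- The domain of the operator of multiplication by `a`. -/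
def MemMulDomain (a : X → ℝ) (f : Lp ℂ 2 μ) : Prop :=
  MemLp (fun x => (a x : ℂ) * f x) 2 μ

open Classical in
/-- The (unbounded) operator of multiplication by `a`, with the value `0` outside its domain. -/
def mulOp (a : X → ℝ) (f : Lp ℂ 2 μ) : Lp ℂ 2 μ :=
  if h : MemLp (fun x => (a x : ℂ) * f x) 2 μ then h.toLp _ else 0

theorem coeFn_mulOp {a : X → ℝ} {f : Lp ℂ 2 μ} (hf : MemMulDomain a f) :
    mulOp a f =ᵐ[μ] fun x => (a x : ℂ) * f x := by
  rw [mulOp, dif_pos (show MemLp (fun x => (a x : ℂ) * f x) 2 μ from hf)]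
  exact MemLp.coeFn_toLp _

theorem memMulDomain_of_ae {a : X → ℝ} {f g : Lp ℂ 2 μ}
    (h : g =ᵐ[μ] fun x => (a x : ℂ) * f x) : MemMulDomain a f ∧ mulOp a f = g := by
  have hf : MemMulDomain a f := (Lp.memLp g).ae_eq h
  exact ⟨hf, Lp.ext ((coeFn_mulOp hf).trans h.symm)⟩

theorem memLp_top_exp {a : X → ℝ} (ha : Measurable a) (t : ℝ) :
    MemLp (fun x => Complex.exp (Complex.I * ((t * a x : ℝ) : ℂ))) ∞ μ := by
  refine memLp_top_of_bound (Measurable.aestronglyMeasurable (by fun_prop)) 1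
    (Eventually.of_forall fun x => ?_)
  rw [mul_comm, Complex.norm_exp_ofReal_mul_I]

/-- The unitary group generated by a multiplication operator. -/
def mulGroup (a : X → ℝ) (ha : Measurable a) (t : ℝ) : Lp ℂ 2 μ →L[ℂ] Lp ℂ 2 μ :=
  mulL2 (fun x => Complex.exp (Complex.I * ((t * a x : ℝ) : ℂ))) (memLp_top_exp ha t)

theorem coeFn_mulGroup {a : X → ℝ} (ha : Measurable a) (t : ℝ) (f : Lp ℂ 2 μ) :
    mulGroup a ha t f =ᵐ[μ] fun x => Complex.exp (Complex.I * ((t * a x : ℝ) : ℂ)) * f x :=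
  coeFn_mulL2 _ _ _

theorem norm_exp_I_mul (x : ℝ) : ‖Complex.exp (Complex.I * (x : ℂ))‖ = 1 := by
  rw [mul_comm, Complex.norm_exp_ofReal_mul_I]

theorem hasDerivAt_exp_I_mul (c t : ℝ) :
    HasDerivAt (fun t : ℝ => Complex.exp (Complex.I * ((t * c : ℝ) : ℂ)))
      (Complex.exp (Complex.I * ((t * c : ℝ) : ℂ)) * (Complex.I * c)) t := by
  have h : HasDerivAt (fun t : ℝ => Complex.I * ((t * c : ℝ) : ℂ)) (Complex.I * c) t := by
    have h1 : HasDerivAt (fun t : ℝ => t * c) c t := by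
      simpa using (hasDerivAt_id t).mul_const c
    exact (h1.ofReal_comp).const_mul Complex.I
  exact h.cexp

theorem continuous_mulGroup {a : X → ℝ} (ha : Measurable a) (f : Lp ℂ 2 μ) :
    Continuous fun t => mulGroup a ha t f := by
  rw [continuous_iff_continuousAt]
  intro t
  refine tendsto_L2_of_dominated (b := fun x => ‖f x‖) (Lp.memLp f).norm
    (fun s => coeFn_mulGroup ha s f) (Eventually.of_forall fun s => Eventually.of_forall fun x => ?_)
    ?_
  · rw [norm_mul, norm_exp_I_mul, one_mul]
  · filter_upwards [coeFn_mulGroup ha t f] with x hx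
    rw [hx]
    exact ((hasDerivAt_exp_I_mul (a x) t).continuousAt.tendsto).mul_const (f x)

/-- Since `|e^{iha} - 1| ≤ |h a|`, the difference quotients are dominated by `|a f|`, which is in
`L²` exactly because `f` is in the domain. -/
theorem hasDerivAt_mulGroup {a : X → ℝ} (ha : Measurable a) {f : Lp ℂ 2 μ}
    (hf : MemMulDomain a f) (t : ℝ) :
    HasDerivAt (fun t => mulGroup a ha t f) (Complex.I • mulGroup a ha t (mulOp a f)) t := by
  rw [hasDerivAt_iff_tendsto_slope_zero]
  refine tendsto_L2_of_dominated (b := fun x => ‖(a x : ℂ) * f x‖)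
    (φ := fun h x => h⁻¹ • (Complex.exp (Complex.I * (((t + h) * a x : ℝ) : ℂ)) -
      Complex.exp (Complex.I * ((t * a x : ℝ) : ℂ))) * f x) (MemLp.norm hf) (fun h => ?_) ?_ ?_
  · filter_upwards [Lp.coeFn_smul h⁻¹ (mulGroup a ha (t + h) f - mulGroup a ha t f),
      Lp.coeFn_sub (mulGroup a ha (t + h) f) (mulGroup a ha t f), coeFn_mulGroup ha (t + h) f,
      coeFn_mulGroup ha t f] with x h1 h2 h3 h4
    rw [h1, Pi.smul_apply, h2, Pi.sub_apply, h3, h4, ← sub_mul, smul_mul_assoc]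
  · filter_upwards [self_mem_nhdsWithin] with h hh
    refine Eventually.of_forall fun x => ?_
    have h1 : Complex.exp (Complex.I * (((t + h) * a x : ℝ) : ℂ)) -
        Complex.exp (Complex.I * ((t * a x : ℝ) : ℂ)) =
        Complex.exp (Complex.I * ((t * a x : ℝ) : ℂ)) *
          (Complex.exp (Complex.I * ((h * a x : ℝ) : ℂ)) - 1) := by
      rw [mul_sub, ← Complex.exp_add, mul_one]
      congr 2
      push_cast
      ring
    have h2 : ‖Complex.exp (Complex.I * ((h * a x : ℝ) : ℂ)) - 1‖ ≤ ‖h * a x‖ :=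
      Real.norm_exp_I_mul_ofReal_sub_one_le
    have hh' : (0 : ℝ) < ‖h‖ := norm_pos_iff.2 hh
    rw [h1, norm_mul, norm_smul, norm_mul, norm_exp_I_mul, one_mul, norm_inv, norm_mul,
      Complex.norm_real]
    refine mul_le_mul_of_nonneg_right ?_ (norm_nonneg _)
    rw [norm_mul] at h2
    rw [inv_mul_le_iff₀ hh']
    exact h2
  · filter_upwards [Lp.coeFn_smul Complex.I (mulGroup a ha t (mulOp a f)),
      coeFn_mulGroup ha t (mulOp a f), coeFn_mulOp hf] with x h1 h2 h3
    rw [h1, Pi.smul_apply, h2, h3]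
    have h := (hasDerivAt_iff_tendsto_slope_zero.1 (hasDerivAt_exp_I_mul (a x) t)).mul_const (f x)
    convert h using 2
    rw [smul_eq_mul]
    ring

/-- The bounded multiplier `r = (1 + |a|)⁻¹` maps all of `L²` into the domain, and `k = a r` is
bounded too. Testing with `r f` for arbitrary `f` gives `r w = a r u`, and `r` can be cancelled
pointwise. -/
theorem mem_of_forall_inner_mulOp {a : X → ℝ} (ha : Measurable a) (u w : Lp ℂ 2 μ)
    (h : ∀ f : Lp ℂ 2 μ, MemMulDomain a f → inner ℂ f w = inner ℂ (mulOp a f) u) :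
    MemMulDomain a u ∧ mulOp a u = w := by
  have hpos : ∀ x, 0 < 1 + |a x| := fun x => by positivity
  let r : X → ℂ := fun x => (((1 + |a x|)⁻¹ : ℝ) : ℂ)
  let k : X → ℂ := fun x => ((a x * (1 + |a x|)⁻¹ : ℝ) : ℂ)
  have hr : MemLp r ∞ μ := by
    refine memLp_top_of_bound (Measurable.aestronglyMeasurable (by fun_prop)) 1
      (Eventually.of_forall fun x => ?_)
    rw [Complex.norm_real, norm_inv, Real.norm_of_nonneg (hpos x).le]
    exact inv_le_one_of_one_le₀ (by linarith [abs_nonneg (a x)])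
  have hk : MemLp k ∞ μ := by
    refine memLp_top_of_bound (Measurable.aestronglyMeasurable (by fun_prop)) 1
      (Eventually.of_forall fun x => ?_)
    rw [Complex.norm_real, norm_mul, norm_inv, Real.norm_of_nonneg (hpos x).le, Real.norm_eq_abs,
      mul_inv_le_iff₀ (hpos x)]
    linarith
  have hRK : mulL2 r hr w = mulL2 k hk u := by
    refine ext_inner_left ℂ fun f => ?_
    have hae : mulL2 k hk f =ᵐ[μ] fun x => (a x : ℂ) * mulL2 r hr f x := by
      filter_upwards [coeFn_mulL2 r hr f, coeFn_mulL2 k hk f] with x h1 h2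
      rw [h1, h2]
      simp only [r, k]
      push_cast
      ring
    obtain ⟨hD, hA⟩ := memMulDomain_of_ae hae
    rw [← inner_mulL2 r hr r hr (fun x => Complex.conj_ofReal _),
      ← inner_mulL2 k hk k hk (fun x => Complex.conj_ofReal _), h _ hD, hA]
  refine memMulDomain_of_ae ?_
  have h0 : mulL2 r hr w =ᵐ[μ] mulL2 k hk u := by rw [hRK]
  filter_upwards [h0, coeFn_mulL2 r hr w, coeFn_mulL2 k hk u] with x h1 h2 h3
  rw [h2, h3] at h1
  have hne : ((1 + |a x| : ℝ) : ℂ) ≠ 0 := Complex.ofReal_ne_zero.2 (hpos x).ne'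
  simp only [r, k, Complex.ofReal_inv, Complex.ofReal_mul] at h1
  field_simp at h1
  exact h1

/-- The operator of multiplication by a real function is self-adjoint. -/
theorem isSelfAdjointGenerator_mulOp {a : X → ℝ} (ha : Measurable a) :
    IsSelfAdjointGenerator (mulGroup (μ := μ) a ha) (MemMulDomain a) (mulOp a) where
  map_zero f := by
    refine Lp.ext ?_
    filter_upwards [coeFn_mulGroup ha 0 f] with x hx
    rw [hx]
    simp
  apply_neg_apply t f := by
    refine Lp.ext ?_
    filter_upwards [coeFn_mulGroup ha t (mulGroup a ha (-t) f), coeFn_mulGroup ha (-t) f]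
      with x h1 h2
    rw [h1, h2, ← mul_assoc, ← Complex.exp_add]
    simp
  inner_left t f g := by
    refine inner_mulL2 _ _ _ _ (fun x => ?_) f g
    rw [← Complex.exp_conj, map_mul, Complex.conj_I, Complex.conj_ofReal]
    push_cast
    ring_nf
  continuous := continuous_mulGroup ha
  hasDerivAt _ hf := hasDerivAt_mulGroup ha hf
  inner_symm f g hf hg := by
    rw [inner_eq_integral_of_ae (coeFn_mulOp hf) (ae_eq_refl _),
      inner_eq_integral_of_ae (ae_eq_refl _) (coeFn_mulOp hg)]
    congr 1
    funext x
    rw [map_mul, Complex.conj_ofReal]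
    ring
  mem_of_forall_inner := mem_of_forall_inner_mulOp ha

end Multiplication

/-- Self-adjointness is preserved by unitary equivalence. -/
theorem IsSelfAdjointGenerator.conj {H H' : Type*} [NormedAddCommGroup H] [InnerProductSpace ℂ H]
    [NormedSpace ℝ H] [NormedAddCommGroup H'] [InnerProductSpace ℂ H'] [NormedSpace ℝ H']
    [IsScalarTower ℝ ℂ H] [IsScalarTower ℝ ℂ H']
    {U : ℝ → H →L[ℂ] H} {D : H → Prop} {A : H → H} (hU : IsSelfAdjointGenerator U D A)
    (F : H' ≃ₗᵢ[ℂ] H) :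
    IsSelfAdjointGenerator (fun t => (F.symm.toContinuousLinearEquiv : H →L[ℂ] H') ∘L U t ∘L
      (F.toContinuousLinearEquiv : H' →L[ℂ] H)) (fun x => D (F x)) (fun x => F.symm (A (F x))) where
  map_zero x := by simp [hU.map_zero]
  apply_neg_apply t x := by simp [hU.apply_neg_apply]
  inner_left t x y := by
    have h1 := F.symm.inner_map_map (U t (F x)) (F y)
    have h2 := F.symm.inner_map_map (F x) (U (-t) (F y))
    simp only [F.symm_apply_apply] at h1 h2
    simp only [ContinuousLinearMap.comp_apply]
    exact h1.trans ((hU.inner_left t _ _).trans h2.symm)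
  continuous x := F.symm.continuous.comp (hU.continuous (F x))
  hasDerivAt x hx t := by
    have h := (((F.symm.toContinuousLinearEquiv : H →L[ℂ] H').restrictScalars
      ℝ).hasFDerivAt.comp_hasDerivAt t (hU.hasDerivAt (F x) hx t))
    refine h.congr_deriv ?_
    simp
  inner_symm x y hx hy := by
    have h1 := F.symm.inner_map_map (A (F x)) (F y)
    have h2 := F.symm.inner_map_map (F x) (A (F y))
    simp only [F.symm_apply_apply] at h1 h2
    exact h1.trans ((hU.inner_symm _ _ hx hy).trans h2.symm)
  mem_of_forall_inner u w h := by
    have := hU.mem_of_forall_inner (F u) (F w) fun x hx => by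
      have h3 := h (F.symm x) (by simpa using hx)
      rw [F.apply_symm_apply] at h3
      have h1 := F.inner_map_map (F.symm x) w
      have h2 := F.inner_map_map (F.symm (A x)) u
      rw [F.apply_symm_apply] at h1 h2
      exact h1.trans (h3.trans h2.symm)
    exact ⟨this.1, by rw [this.2, F.symm_apply_apply]⟩

end

/-! ### The Klein-Gordon equation with a bounded nonnegative mass -/

/-- The Fourier transform is unitary on `L²` and carries the operator to multiplication by a real
symbol. The default values `0` outside the domains also correspond, so the two operators agree on
all of `L²`. -/
theorem exists_isSelfAdjointGenerator_fracLaplacian (d : ℕ) (α : ℝ) :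
    ∃ U : ℝ → L2 d →L[ℂ] L2 d,
      IsSelfAdjointGenerator U (MemH α) (fracLaplacian (α / 2)) := by
  have ha : Measurable fun ξ : Space d => (2 * Real.pi * ‖ξ‖) ^ (2 * (α / 2)) := by fun_prop
  have h := (isSelfAdjointGenerator_mulOp (μ := (volume : Measure (Space d))) ha).conj
    (Lp.fourierTransformₗᵢ (Space d) ℂ)
  have hA : (fracLaplacian (α / 2) : L2 d → L2 d) = fun f =>
      (Lp.fourierTransformₗᵢ (Space d) ℂ).symm
        (mulOp (fun ξ : Space d => (2 * Real.pi * ‖ξ‖) ^ (2 * (α / 2)))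
          (Lp.fourierTransformₗᵢ (Space d) ℂ f)) := by
    funext f
    by_cases hf : MemLp (fracSymbolMul (α / 2) f) 2 volume
    · rw [fracLaplacian, dif_pos hf, mulOp]
      exact congrArg _ (dif_pos hf).symm
    · rw [fracLaplacian, dif_neg hf, mulOp]
      refine ((congrArg _ (dif_neg hf)).trans (map_zero _)).symm
  rw [hA]
  exact ⟨_, h⟩

theorem ae_le_of_eLpNorm_top_le {d : ℕ} {μ : Space d → ℝ} {B : ℝ} (hB : 0 ≤ B)
    (h : eLpNorm μ ∞ volume ≤ ENNReal.ofReal B) : ∀ᵐ x, μ x ≤ B := by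
  rw [eLpNorm_exponent_top] at h
  filter_upwards [enorm_ae_le_eLpNormEssSup μ volume] with x hx
  have h1 := hx.trans h
  rw [← ofReal_norm, ENNReal.ofReal_le_ofReal_iff hB] at h1
  exact (le_abs_self _).trans h1

/-- Existence and energy estimate for a bounded nonnegative mass. -/
theorem exists_isSolution {d : ℕ} {α T : ℝ} (hT : 0 < T) {μ : Space d → ℝ}
    (hμ : MemLp μ ∞ volume) (hμ0 : ∀ x, 0 ≤ μ x) {B : ℝ} (hB : 0 ≤ B)
    (hμB : eLpNorm μ ∞ volume ≤ ENNReal.ofReal B) {u₀ : L2 d} (hu₀ : MemH α u₀) (u₁ : L2 d) :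
    ∃ u : ℝ → L2 d, IsSolution α T μ u₀ u₁ u ∧ ∀ t ∈ Icc 0 T, energyNorm α T u t ≤
      ‖u₀‖ + (2 + T) * √(‖u₁‖ ^ 2 + ‖fracLaplacian (α / 2) u₀‖ ^ 2 + B * ‖u₀‖ ^ 2) := by
  obtain ⟨U, hU⟩ := exists_isSelfAdjointGenerator_fracLaplacian d α
  have hμc : MemLp (fun x => (μ x : ℂ)) ∞ volume := hμ.ofReal
  let M : L2 d →L[ℂ] L2 d := mulL2 (fun x => (μ x : ℂ)) hμc
  have hM : ∀ x y, inner ℂ (M x) y = inner ℂ x (M y) :=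
    inner_mulL2 _ hμc _ hμc fun x => Complex.conj_ofReal _
  have hMint : ∀ f g : L2 d, (inner ℂ f (M g) : ℂ) = ∫ x, conj (f x) * ((μ x : ℂ) * g x) :=
    fun f g => inner_eq_integral_of_ae (ae_eq_refl _) (coeFn_mulL2 _ hμc g)
  have hMre : ∀ f : L2 d, (inner ℂ f (M f)).re = ∫ x, μ x * ‖f x‖ ^ 2 := by
    intro f
    have h : (inner ℂ f (M f) : ℂ) = ∫ x, ((μ x * ‖f x‖ ^ 2 : ℝ) : ℂ) := by
      rw [hMint]
      congr 1
      funext x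
      rw [mul_left_comm, Complex.conj_mul']
      push_cast
      rfl
    rw [h, integral_complex_ofReal, Complex.ofReal_re]
  have hMnonneg : ∀ f : L2 d, 0 ≤ (inner ℂ f (M f)).re := fun f => by
    rw [hMre]
    exact integral_nonneg fun x => mul_nonneg (hμ0 x) (by positivity)
  have hMle : ∀ f : L2 d, (inner ℂ f (M f)).re ≤ B * ‖f‖ ^ 2 := fun f => by
    rw [hMre, norm_sq_eq_integral, ← integral_const_mul]
    refine integral_mono_of_nonneg
      (Eventually.of_forall fun x => mul_nonneg (hμ0 x) (by positivity))
      ((Lp.memLp f).norm.integrable_sq.const_mul B) ?_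
    filter_upwards [ae_le_of_eLpNorm_top_le hB hμB] with x hx
    exact mul_le_mul_of_nonneg_right hx (by positivity)
  obtain ⟨u, v, hu0, hv0, hvc, hdu, huD, hAc, heq, hE⟩ := hU.exists_wave M hM hT.le hu₀ u₁
  have hderiv : ∀ t ∈ Icc 0 T, timeDeriv T u t = v t := fun t ht =>
    (hdu t ht).hasDerivWithinAt.derivWithin (uniqueDiffOn_Icc hT t ht)
  set R := √(‖u₁‖ ^ 2 + ‖fracLaplacian (α / 2) u₀‖ ^ 2 + B * ‖u₀‖ ^ 2) with hR
  -- Nonnegativity of the mass allows the potential energy at time `t` to be dropped; its upper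
  -- bound is used only at time `0`.
  have hbound : ∀ t ∈ Icc 0 T, ‖v t‖ ≤ R ∧ ‖fracLaplacian (α / 2) (u t)‖ ≤ R := by
    intro t ht
    have h1 := hE t ht
    have h2 := hMnonneg (u t)
    have h3 := hMle u₀
    have h4 := sq_nonneg ‖v t‖
    have h5 := sq_nonneg ‖fracLaplacian (α / 2) (u t)‖
    exact ⟨Real.le_sqrt_of_sq_le (by linarith), Real.le_sqrt_of_sq_le (by linarith)⟩
  refine ⟨u, ⟨⟨huD, fun t ht => ?_⟩, ?_, fun φ hφ t ht => ?_, hu0, ?_⟩, fun t ht => ?_⟩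
  · have hu : Tendsto (fun s => ‖u s - u t‖) (𝓝[Icc 0 T] t) (𝓝 0) :=
      tendsto_iff_norm_sub_tendsto_zero.1 (hdu t ht).continuousAt.continuousWithinAt
    have hA := tendsto_iff_norm_sub_tendsto_zero.1 (hAc t ht)
    have hsum := hu.add hA
    rw [add_zero] at hsum
    refine hsum.congr' ?_
    filter_upwards [self_mem_nhdsWithin] with s hs
    rw [normH, (hU.sub_mem (huD s hs) (huD t ht)).2]
  · rw [contDiffOn_one_iff_derivWithin (uniqueDiffOn_Icc hT)]
    exact ⟨fun t ht => (hdu t ht).differentiableAt.differentiableWithinAt,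
      hvc.continuousOn.congr hderiv⟩
  · have h := (heq φ hφ t ht).hasDerivWithinAt (s := Icc 0 T)
    rw [hMint] at h
    exact h.congr (fun s hs => by rw [hderiv s hs]) (by rw [hderiv t ht])
  · rw [hderiv 0 ⟨le_rfl, hT.le⟩, hv0]
  -- The energy need not control `‖u t‖`, since the mass may vanish. Integrating the velocity costs
  -- `T * R`; the other two terms of the norm cost `R` each, whence the factor `2 + T`.
  · have hut : ‖u t - u 0‖ ≤ R * (t - 0) :=
      norm_image_sub_le_of_norm_deriv_le_segment'
        (fun s hs => (hdu s hs).hasDerivWithinAt)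
        (fun s hs => (hbound s ⟨hs.1, hs.2.le⟩).1) t ht
    have h1 : ‖u t‖ ≤ ‖u₀‖ + ‖u t - u 0‖ := by
      rw [← hu0]
      simpa using norm_add_le (u 0) (u t - u 0)
    have hR0 : 0 ≤ R := Real.sqrt_nonneg _
    have h2 : R * (t - 0) ≤ R * T := by
      gcongr
      linarith [ht.2]
    obtain ⟨h3, h4⟩ := hbound t ht
    rw [energyNorm, normH, hderiv t ht]
    linarith

end KleinGordon

/-! ### Uniform bounds in `ε` and the very weak solution -/

theorem mainTheorem2 {d : ℕ} (hd : 0 < d) {α T : ℝ} (hα : 0 < α) (hT : 0 < T)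
    (m : KleinGordon.SingularMass d)
    (ψ : 𝓓((⊤ : TopologicalSpace.Opens (KleinGordon.Space d)), ℝ))
    (hψ : KleinGordon.IsMollifier ψ)
    (hm_nonneg : ∀ (ε : KleinGordon.Param) (x : KleinGordon.Space d), 0 ≤ m.regularise ψ ε x)
    (N₀ : ℕ) (C₀ : ℝ) (hC₀ : 0 < C₀)
    (hm_moderate : KleinGordon.LInftyBound (m.regularise ψ) N₀ C₀)
    (u₀ u₁ : KleinGordon.L2 d) (hu₀ : KleinGordon.MemH α u₀) :
    ∃ u : KleinGordon.Param → ℝ → KleinGordon.L2 d,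
      KleinGordon.IsVeryWeakSolution α T m u₀ u₁ u ∧
      (∀ ε : KleinGordon.Param,
        KleinGordon.IsSolution α T (m.regularise ψ ε) u₀ u₁ (u ε)) ∧
      ∃ C : ℝ, 0 < C ∧ ∀ ε : KleinGordon.Param, ∀ t ∈ Set.Icc 0 T,
        KleinGordon.energyNorm α T (u ε) t ≤ C * (ε : ℝ) ^ (-(N₀ : ℝ) / 2) := by
  have hB : ∀ ε : KleinGordon.Param, 0 ≤ C₀ * (ε : ℝ) ^ (-(N₀ : ℝ)) := fun ε =>
    mul_nonneg hC₀.le (Real.rpow_nonneg ε.2.1.le _)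
  choose u hu huE using fun ε : KleinGordon.Param =>
    KleinGordon.exists_isSolution (α := α) hT (hm_moderate ε).1 (hm_nonneg ε) (hB ε)
      (hm_moderate ε).2 hu₀ u₁
  set S := ‖u₁‖ ^ 2 + ‖KleinGordon.fracLaplacian (α / 2) u₀‖ ^ 2 with hS
  -- This is the energy bound at `ε = 1`; the `+ 1` makes it positive even for zero data.
  set C := ‖u₀‖ + (2 + T) * √(S + C₀ * ‖u₀‖ ^ 2) + 1 with hC
  have hCpos : 0 < C := by positivity
  have hbound : ∀ ε : KleinGordon.Param, ∀ t ∈ Set.Icc 0 T,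
      KleinGordon.energyNorm α T (u ε) t ≤ C * (ε : ℝ) ^ (-(N₀ : ℝ) / 2) := by
    intro ε t ht
    have hε : (0 : ℝ) < ε := ε.2.1
    -- The mass bound is `C₀ e²`, and the square root in the energy estimate halves the exponent.
    -- Since `e ≥ 1`, the terms free of `ε` are absorbed.
    set e := (ε : ℝ) ^ (-(N₀ : ℝ) / 2) with he
    have he1 : 1 ≤ e := Real.one_le_rpow_of_pos_of_le_one_of_nonpos hε ε.2.2
      (div_nonpos_of_nonpos_of_nonneg (neg_nonpos.2 N₀.cast_nonneg) zero_le_two)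
    have hee : (ε : ℝ) ^ (-(N₀ : ℝ)) = e ^ 2 := by
      rw [he, ← Real.rpow_natCast, ← Real.rpow_mul hε.le]
      congr 1
      push_cast
      ring
    have hSnonneg : 0 ≤ S := by positivity
    have hsqrt : √(S + C₀ * (ε : ℝ) ^ (-(N₀ : ℝ)) * ‖u₀‖ ^ 2) ≤ √(S + C₀ * ‖u₀‖ ^ 2) * e := by
      rw [hee]
      refine Real.sqrt_le_iff.2 ⟨by positivity, ?_⟩
      rw [mul_pow, Real.sq_sqrt (by positivity)]
      nlinarith [one_le_pow₀ he1 (n := 2)]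
    calc KleinGordon.energyNorm α T (u ε) t
        ≤ ‖u₀‖ + (2 + T) * √(S + C₀ * (ε : ℝ) ^ (-(N₀ : ℝ)) * ‖u₀‖ ^ 2) := huE ε t ht
      _ ≤ ‖u₀‖ * e + (2 + T) * (√(S + C₀ * ‖u₀‖ ^ 2) * e) := by
        gcongr
        exact le_mul_of_one_le_right (norm_nonneg _) he1
      _ ≤ C * e := by
        rw [hC]
        nlinarith
  refine ⟨u, ⟨⟨ψ, hψ, ⟨N₀, C₀, hC₀, hm_moderate⟩, hu⟩, N₀, C, hCpos, fun ε t ht => ?_⟩, hu,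
    C, hCpos, hbound⟩
  -- Moderateness asks for an integer exponent, so `N₀ / 2` is weakened to `N₀`, using `ε ≤ 1`.
  refine (hbound ε t ht).trans (mul_le_mul_of_nonneg_left ?_ hCpos.le)
  refine Real.rpow_le_rpow_of_exponent_ge ε.2.1 ε.2.2 ?_
  have : (0 : ℝ) ≤ N₀ := N₀.cast_nonneg
  linarith
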